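/- Let $d\ge 1$, let $\alpha_1,\dots,\alpha_d$ be real numbers with $0\le\alpha_j<1$ for all $j$, and suppose $\alpha:=\alpha_1+\cdots+\alpha_d<2$. Let $W^{1,2}(\mathbb R^d)$ be the Sobolev space of real functions $f\in L^2(\mathbb R^d)$ whose weak gradient $\nabla f$ is in $L^2(\mathbb R^d)$, and let $\mathcal F_d(\mathbb R^d)=\{g\in W^{1,2}(\mathbb R^d):\|g\|_2=1\}$. Then for every $\theta>0$ $$\sup_{g\in\mathcal F_d(\mathbb R^d)}\Big\{\theta\int_{\mathbb R^d}\Big(\prod_{j=1}^d|x_j|^{-\alpha_j}\Big)g^2(x)\,dx-\frac12\int_{\mathbb R^d}|\nabla g(x)|^2\,dx\Big\}<\infty .$$ Moreover, there is a constant $C>0$, depending only on $d$ and $\alpha_1,\dots,\alpha_d$, such that for every $f\in W^{1,2}(\mathbb R^d)$ $$\int_{\mathbb R^d}\Big(\prod_{j=1}^d|x_j|^{-\alpha_j}\Big)f^2(x)\,dx\le C\,\|f\|_2^{2-\alpha}\,\|\nabla f\|_2^{\alpha}$$ and $$\int_{\mathbb R^d\times\mathbb R^d}\Big(\prod_{j=1}^d|x_j-y_j|^{-\alpha_j}\Big)f^2(x)f^2(y)\,dx\,dy\le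 C\,\|f\|_2^{4-\alpha}\,\|\nabla f\|_2^{\alpha},$$ where $0^0=1$. -/

import Mathlib

open MeasureTheory
open scoped ENNReal ContDiff

noncomputable section

/-- `G` is the weak (distributional) gradient of `f` on `ℝ^d`: both are locally integrable and
`∫ f ∂_j φ = - ∫ G_j φ` for every coordinate `j` and every smooth compactly supported `φ`. -/
structure HasWeakGradient {d : ℕ} (f : EuclideanSpace ℝ (Fin d) → ℝ)
    (G : EuclideanSpace ℝ (Fin d) → EuclideanSpace ℝ (Fin d)) : Prop where
  locallyIntegrable : LocallyIntegrable f volume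
  locallyIntegrable_grad : LocallyIntegrable G volume
  integral_eq : ∀ φ : EuclideanSpace ℝ (Fin d) → ℝ, ContDiff ℝ ∞ φ → HasCompactSupport φ →
    ∀ j : Fin d, ∫ x, f x * fderiv ℝ φ x (EuclideanSpace.single j 1) = - ∫ x, G x j * φ x

/-- The weak gradient `∇f`, a function defined up to a null set (see `HasWeakGradient.ae_eq`);
it is set to `0` if `f` has no weak gradient. -/
def weakGrad {d : ℕ} (f : EuclideanSpace ℝ (Fin d) → ℝ) :
    EuclideanSpace ℝ (Fin d) → EuclideanSpace ℝ (Fin d) :=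
  open Classical in if h : ∃ G, HasWeakGradient f G then h.choose else 0

/-- The Sobolev space `W^{1,2}(ℝ^d)` of real functions `f ∈ L²` with weak gradient `∇f ∈ L²`. -/
def sobolevW12 (d : ℕ) : Set (EuclideanSpace ℝ (Fin d) → ℝ) :=
  {f | MemLp f 2 volume ∧ ∃ G, HasWeakGradient f G ∧ MemLp G 2 volume}

/-- The set `𝓕_d(ℝ^d)` of all `g ∈ W^{1,2}(ℝ^d)` with `‖g‖₂ = 1`. -/
def unitSobolev (d : ℕ) : Set (EuclideanSpace ℝ (Fin d) → ℝ) :=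
  {g | g ∈ sobolevW12 d ∧ eLpNorm g 2 volume = 1}

/-- The kernel `∏_j |x_j|^{-α_j}`, with values in `[0, ∞]` (a factor with `x_j = 0` is `∞` if
`α_j > 0` and `1` if `α_j = 0`; every factor is strictly positive). -/
def prodKernel {d : ℕ} (α : Fin d → ℝ) (x : EuclideanSpace ℝ (Fin d)) : ℝ≥0∞ :=
  ∏ j, ‖x j‖ₑ ^ (-α j)

/-- The weak gradient is unique up to a null set. -/
theorem HasWeakGradient.ae_eq {d : ℕ} {f : EuclideanSpace ℝ (Fin d) → ℝ}
    {G H : EuclideanSpace ℝ (Fin d) → EuclideanSpace ℝ (Fin d)}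
    (hG : HasWeakGradient f G) (hH : HasWeakGradient f H) : G =ᵐ[volume] H := by
  have coord : ∀ {K : EuclideanSpace ℝ (Fin d) → EuclideanSpace ℝ (Fin d)},
      LocallyIntegrable K volume → ∀ j, LocallyIntegrable (fun x => K x j) volume := by
    intro K hK j x
    obtain ⟨s, hs, hi⟩ := hK x
    exact ⟨s, hs, (EuclideanSpace.proj (𝕜 := ℝ) j).integrable_comp hi⟩
  have key : ∀ j : Fin d, ∀ᵐ x ∂(volume : Measure (EuclideanSpace ℝ (Fin d))),
      G x j = H x j := by
    intro j
    have hGj := coord hG.locallyIntegrable_grad j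
    have hHj := coord hH.locallyIntegrable_grad j
    refine ae_eq_of_integral_contDiff_smul_eq hGj hHj fun φ hφ hc => ?_
    have h1 := hG.integral_eq φ hφ hc j
    have h2 := hH.integral_eq φ hφ hc j
    simp only [smul_eq_mul, mul_comm (φ _)]
    linarith
  filter_upwards [ae_all_iff.2 key] with x hx
  ext j
  exact hx j

/-- On `W^{1,2}(ℝ^d)` the function `weakGrad f` is the weak gradient of `f`, and it is in `L²`. -/
theorem weakGrad_spec {d : ℕ} {f : EuclideanSpace ℝ (Fin d) → ℝ} (hf : f ∈ sobolevW12 d) :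
    HasWeakGradient f (weakGrad f) ∧ MemLp (weakGrad f) 2 volume := by
  obtain ⟨_, G, hG, hL⟩ := hf
  have h : ∃ G, HasWeakGradient f G := ⟨G, hG⟩
  have hw : HasWeakGradient f (weakGrad f) := by
    rw [weakGrad, dif_pos h]
    exact h.choose_spec
  exact ⟨hw, hL.ae_eq (hG.ae_eq hw)⟩

end

/-! Everything follows from one form bound at unit scale: the integral of the kernel against `f²` is
at most a constant times `‖f‖₂² + ‖∇f‖₂²`. The kernel is homogeneous of degree `-α`, so applying
this bound to `x ↦ f (δ • x + y)` gives `C (δ^(-α) ‖f‖₂² + δ^(2-α) ‖∇f‖₂²)` for every scale `δ` and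
every centre `y`. Since `α < 2`, a suitable `δ` makes the gradient coefficient equal to one half,
which bounds the supremum. The choice `δ = ‖f‖₂ / ‖∇f‖₂` gives the multiplicative inequality. That
inequality is uniform in `y`, so integrating it against `f²(y)` gives the interaction bound.

For the form bound, choose `c < 1` above every `α_j` with `2c` at least their sum. At each point the
kernel is then at most the product of the `c`-th powers of its two largest bases `max 1 |x_j|⁻¹`, so
at most two coordinates are singular at a time (`prod_rpow_le_of_sum_le`). For one coordinate,
Sobolev functions on the line are bounded and the truncated power is integrable. For two, there is
no `L^∞` bound, but planar Sobolev functions lie in every `L^(2m)` (`lintegral_pow_le_plane`), and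
Hölder pairs this with a truncated kernel in some `L^p`, `p > 1`. The remaining variables are
integrated out by Tonelli. Mollification and Fatou extend the result from smooth functions to
`W^{1,2}` (`HasWeakGradient.exists_contDiff_approx`). -/

open MeasureTheory
open scoped ENNReal ContDiff

noncomputable section
-- Truncated powers and Sobolev bounds on the line
/-- The power `|t|^{-c}` cut off to `|t| < 1`, with values in `[0, ∞]`. -/
def truncKernel (c : ℝ) : ℝ → ℝ≥0∞ :=
  (Set.Ioo (-1) 1).indicator fun t => ‖t‖ₑ ^ (-c)

theorem measurable_truncKernel (c : ℝ) : Measurable (truncKernel c) :=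
  (measurable_enorm.pow_const _).indicator measurableSet_Ioo

theorem truncKernel_rpow (c : ℝ) {p : ℝ} (hp : 0 < p) (t : ℝ) :
    truncKernel c t ^ p = truncKernel (c * p) t := by
  by_cases h : t ∈ Set.Ioo (-1 : ℝ) 1
  · simp only [truncKernel, Set.indicator_of_mem h]
    rw [← ENNReal.rpow_mul, neg_mul]
  · simp only [truncKernel, Set.indicator_of_notMem h, ENNReal.zero_rpow_of_pos hp]

theorem lintegral_truncKernel_lt_top {c : ℝ} (hc : c < 1) :
    ∫⁻ t, truncKernel c t < ⊤ := by
  have hpos : ∫⁻ t in Set.Ioo (0 : ℝ) 1, ‖t‖ₑ ^ (-c) < ⊤ := by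
    have h : IntegrableOn (fun t : ℝ => t ^ (-c)) (Set.Ioo 0 1) :=
      (intervalIntegral.integrableOn_Ioo_rpow_iff one_pos).2 (by linarith)
    refine lt_of_le_of_lt (le_of_eq ?_) h.2
    refine setLIntegral_congr_fun measurableSet_Ioo fun t ht => ?_
    have ht0 : 0 < t := ht.1
    simp only [Real.enorm_eq_ofReal ht0.le, Real.enorm_eq_ofReal (Real.rpow_nonneg ht0.le _),
      ENNReal.ofReal_rpow_of_pos ht0]
  have hneg : ∫⁻ t in Set.Ioo (-1 : ℝ) 0, ‖t‖ₑ ^ (-c) < ⊤ := by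
    have h := (Measure.measurePreserving_neg (volume : Measure ℝ)).setLIntegral_comp_preimage_emb
      (MeasurableEquiv.neg ℝ).measurableEmbedding (fun t : ℝ => ‖t‖ₑ ^ (-c)) (Set.Ioo (0 : ℝ) 1)
    simp only [enorm_neg, Set.neg_preimage, Set.neg_Ioo, neg_zero] at h
    rwa [h]
  rw [show (fun t => truncKernel c t) = (Set.Ioo (-1 : ℝ) 1).indicator fun t => ‖t‖ₑ ^ (-c)
    from rfl, lintegral_indicator measurableSet_Ioo]
  -- The kernel may be infinite at the origin, but a single point is null.
  have hsub : Set.Ioo (-1 : ℝ) 1 ⊆ (Set.Ioo (-1 : ℝ) 0 ∪ Set.Ioo 0 1) ∪ {0} := by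
    intro t ht
    rcases lt_trichotomy t 0 with h | h | h
    · exact Or.inl (Or.inl ⟨ht.1, h⟩)
    · exact Or.inr h
    · exact Or.inl (Or.inr ⟨h, ht.2⟩)
  refine (lintegral_mono_set hsub).trans_lt ((lintegral_union_le _ _ _).trans_lt ?_)
  refine ENNReal.add_lt_top.2 ⟨(lintegral_union_le _ _ _).trans_lt
    (ENNReal.add_lt_top.2 ⟨hneg, hpos⟩), ?_⟩
  simp

/-- A continuously differentiable function on the line that lies in `L²` is controlled pointwise
by the integral of the derivative of its powers. -/
theorem enorm_pow_le_lintegral_deriv {h h' : ℝ → ℝ} (hd : ∀ x, HasDerivAt h (h' x) x)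
    (hc : Continuous h') (hL : ∫⁻ x, ‖h x‖ₑ ^ 2 ≠ ⊤) (m : ℕ) (x : ℝ) :
    ‖h x‖ₑ ^ (m + 1) ≤ (m + 1 : ℕ) * ∫⁻ y, ‖h y‖ₑ ^ m * ‖h' y‖ₑ := by
  have hcont : Continuous h := continuous_iff_continuousAt.2 fun x => (hd x).continuousAt
  set I := (m + 1 : ℕ) * ∫⁻ y, ‖h y‖ₑ ^ m * ‖h' y‖ₑ with hI
  -- The base point `a` is kept free: an `L²` function need not tend to zero a priori, but it has
  -- arbitrarily small values.
  have key : ∀ a, ‖h x‖ₑ ^ (m + 1) ≤ ‖h a‖ₑ ^ (m + 1) + I := by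
    intro a
    have hder : ∀ y, HasDerivAt (fun y => h y ^ (m + 1)) ((m + 1 : ℕ) * (h y ^ m * h' y)) y := by
      intro y
      have := (hd y).fun_pow (m + 1)
      simpa [mul_assoc] using this
    have hftc : ∫ y in a..x, ((m + 1 : ℕ) : ℝ) * (h y ^ m * h' y) = h x ^ (m + 1) - h a ^ (m + 1) :=
      intervalIntegral.integral_eq_sub_of_hasDerivAt (fun y _ => hder y)
        (Continuous.intervalIntegrable (by fun_prop) _ _)
    have hle : ‖h x ^ (m + 1) - h a ^ (m + 1)‖ₑ ≤ I := by
      rw [← hftc]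
      have h1 : ‖∫ y in a..x, ((m + 1 : ℕ) : ℝ) * (h y ^ m * h' y)‖ₑ
          ≤ ∫⁻ y in Set.uIoc a x, ‖((m + 1 : ℕ) : ℝ) * (h y ^ m * h' y)‖ₑ := by
        rw [← ofReal_norm, intervalIntegral.norm_intervalIntegral_eq,
          ofReal_norm]
        exact enorm_integral_le_lintegral_enorm _
      refine h1.trans ((setLIntegral_le_lintegral _ _).trans (le_of_eq ?_))
      rw [hI, ← lintegral_const_mul' _ _ (ENNReal.natCast_ne_top _)]
      refine lintegral_congr fun y => ?_
      rw [enorm_mul, enorm_mul, enorm_pow, Real.enorm_natCast]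
    calc ‖h x‖ₑ ^ (m + 1) = ‖h a ^ (m + 1) + (h x ^ (m + 1) - h a ^ (m + 1))‖ₑ := by
          rw [← enorm_pow]; congr 1; ring
      _ ≤ ‖h a ^ (m + 1)‖ₑ + ‖h x ^ (m + 1) - h a ^ (m + 1)‖ₑ := enorm_add_le _ _
      _ ≤ _ := by rw [enorm_pow]; gcongr
  -- If the bound failed, `key` would keep `|h|` above a fixed positive level on the whole line,
  -- against `h ∈ L²`.
  by_contra hlt
  rw [not_le] at hlt
  set ε := ‖h x‖ₑ ^ (m + 1) - I with hε
  have hε0 : ε ≠ 0 := (tsub_pos_of_lt hlt).ne'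
  have hlow : ∀ a, ε ^ ((m + 1 : ℝ)⁻¹ * 2) ≤ ‖h a‖ₑ ^ 2 := by
    intro a
    have h1 : ε ≤ ‖h a‖ₑ ^ (m + 1) := tsub_le_iff_right.2 (key a)
    calc ε ^ ((m + 1 : ℝ)⁻¹ * 2) ≤ (‖h a‖ₑ ^ (m + 1)) ^ ((m + 1 : ℝ)⁻¹ * 2) := by
          gcongr
      _ = ‖h a‖ₑ ^ 2 := by
          rw [← ENNReal.rpow_natCast, ← ENNReal.rpow_mul, ← mul_assoc]
          push_cast
          rw [mul_inv_cancel₀ (by positivity), one_mul]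
          exact_mod_cast ENNReal.rpow_natCast _ 2
  apply hL
  rw [eq_top_iff]
  refine le_trans (le_of_eq ?_) (lintegral_mono hlow)
  rw [lintegral_const, Real.volume_univ, ENNReal.mul_top]
  exact (ENNReal.rpow_pos (pos_iff_ne_zero.2 hε0)
    ((tsub_le_self.trans_lt (ENNReal.pow_lt_top enorm_lt_top)).ne)).ne'

theorem Continuous.measurable_enorm_sq {X : Type*} [TopologicalSpace X] [MeasurableSpace X]
    [OpensMeasurableSpace X] {f : X → ℝ} (hf : Continuous f) : Measurable fun x => ‖f x‖ₑ ^ 2 :=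
  hf.measurable.enorm.pow_const 2

/-- Cauchy–Schwarz for the Lebesgue integral. -/
theorem lintegral_mul_sq_le {X : Type*} [MeasurableSpace X] {μ : Measure X} {f g : X → ℝ≥0∞}
    (hf : AEMeasurable f μ) (hg : AEMeasurable g μ) :
    (∫⁻ x, f x * g x ∂μ) ^ 2 ≤ (∫⁻ x, f x ^ 2 ∂μ) * ∫⁻ x, g x ^ 2 ∂μ := by
  have h := ENNReal.lintegral_mul_le_Lp_mul_Lq μ Real.HolderConjugate.two_two hf hg
  calc (∫⁻ x, f x * g x ∂μ) ^ 2
      ≤ ((∫⁻ x, f x ^ (2 : ℝ) ∂μ) ^ (1 / 2 : ℝ) * (∫⁻ x, g x ^ (2 : ℝ) ∂μ) ^ (1 / 2 : ℝ)) ^ 2 := by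
        gcongr
        exact h
    _ = _ := by
        rw [mul_pow, ← ENNReal.rpow_natCast, ← ENNReal.rpow_mul, ← ENNReal.rpow_natCast,
          ← ENNReal.rpow_mul]
        norm_num

/-- On the line, the truncated kernel is form bounded by the Sobolev norm. -/
theorem exists_lintegral_truncKernel_mul_sq_le {c : ℝ} (hc : c < 1) :
    ∃ C : ℝ≥0∞, C ≠ ⊤ ∧ ∀ h h' : ℝ → ℝ, (∀ x, HasDerivAt h (h' x) x) → Continuous h' →
      ∫⁻ x, truncKernel c x * ‖h x‖ₑ ^ 2
        ≤ C * ((∫⁻ x, ‖h x‖ₑ ^ 2) + ∫⁻ x, ‖h' x‖ₑ ^ 2) := by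
  -- The summand 1 makes the constant nonzero, so the right side is infinite when `h` is not in
  -- `L²`; no integrability hypothesis is then needed.
  refine ⟨(∫⁻ t, truncKernel c t) * 2 + 1,
    by simp [ENNReal.mul_eq_top, (lintegral_truncKernel_lt_top hc).ne], fun h h' hd hc' => ?_⟩
  have hcont : Continuous h := continuous_iff_continuousAt.2 fun x => (hd x).continuousAt
  by_cases hL : ∫⁻ x, ‖h x‖ₑ ^ 2 = ⊤
  · rw [hL, top_add, ENNReal.mul_top (by simp)]
    exact le_top
  set S := (∫⁻ x, ‖h x‖ₑ ^ 2) + ∫⁻ x, ‖h' x‖ₑ ^ 2 with hS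
  have hsup : ∀ x, ‖h x‖ₑ ^ 2 ≤ 2 * S := by
    intro x
    refine (enorm_pow_le_lintegral_deriv hd hc' hL 1 x).trans ?_
    rw [hS, ← lintegral_add_left (by fun_prop)]
    norm_num
    gcongr with y
    rcases le_total ‖h y‖ₑ ‖h' y‖ₑ with hle | hle
    · calc ‖h y‖ₑ * ‖h' y‖ₑ ≤ ‖h' y‖ₑ * ‖h' y‖ₑ := by gcongr
        _ ≤ _ := by rw [← sq]; exact le_add_self
    · calc ‖h y‖ₑ * ‖h' y‖ₑ ≤ ‖h y‖ₑ * ‖h y‖ₑ := by gcongr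
        _ ≤ _ := by rw [← sq]; exact le_self_add
  calc ∫⁻ x, truncKernel c x * ‖h x‖ₑ ^ 2 ≤ ∫⁻ x, truncKernel c x * (2 * S) := by
        gcongr with x; exact hsup x
    _ = (∫⁻ t, truncKernel c t) * 2 * S := by
        rw [lintegral_mul_const _ (measurable_truncKernel c), mul_assoc]
    _ ≤ _ := by gcongr; exact le_self_add

/-! ### Sobolev embedding and Hölder in the plane -/

section Plane

variable {f D₁ D₂ : ℝ × ℝ → ℝ}

/-- One step of the Gagliardo iteration in the plane. -/
theorem lintegral_pow_succ_le_plane (hD₁ : Continuous D₁) (hD₂ : Continuous D₂)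
    (hf : Continuous f) (h₁ : ∀ s t, HasDerivAt (fun s => f (s, t)) (D₁ (s, t)) s)
    (h₂ : ∀ s t, HasDerivAt (fun t => f (s, t)) (D₂ (s, t)) t)
    (hL : ∫⁻ z, ‖f z‖ₑ ^ 2 ≠ ⊤) (m : ℕ) :
    ∫⁻ z, ‖f z‖ₑ ^ (2 * (m + 1)) ≤ (m + 1 : ℕ) ^ 2 * (∫⁻ z, ‖f z‖ₑ ^ (2 * m))
      * ((∫⁻ z, ‖D₁ z‖ₑ ^ 2) + ∫⁻ z, ‖D₂ z‖ₑ ^ 2) := by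
  set N := (∫⁻ z, ‖D₁ z‖ₑ ^ 2) + ∫⁻ z, ‖D₂ z‖ₑ ^ 2 with hN
  set X := ∫⁻ z, ‖f z‖ₑ ^ (2 * m) with hX
  set P : ℝ → ℝ≥0∞ := fun t => (m + 1 : ℕ) * ∫⁻ s, ‖f (s, t)‖ₑ ^ m * ‖D₁ (s, t)‖ₑ with hP
  set Q : ℝ → ℝ≥0∞ := fun s => (m + 1 : ℕ) * ∫⁻ t, ‖f (s, t)‖ₑ ^ m * ‖D₂ (s, t)‖ₑ with hQ
  have mf : Measurable fun z => ‖f z‖ₑ ^ 2 := by fun_prop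
  have m1 : Measurable fun z => ‖f z‖ₑ ^ m * ‖D₁ z‖ₑ := by fun_prop
  have m2 : Measurable fun z => ‖f z‖ₑ ^ m * ‖D₂ z‖ₑ := by fun_prop
  have hPm : Measurable P := m1.lintegral_prod_left'.const_mul _
  have hQm : Measurable Q := m2.lintegral_prod_right'.const_mul _
  -- By Tonelli only almost every slice is in `L²`, so the one-dimensional bound is available for
  -- almost every line.
  have ht : ∀ᵐ t, ∀ s, ‖f (s, t)‖ₑ ^ (m + 1) ≤ P t := by
    have hL' := hL
    rw [Measure.volume_eq_prod, lintegral_prod_symm' _ mf] at hL'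
    filter_upwards [ae_lt_top mf.lintegral_prod_left' hL'] with t ht s
    exact enorm_pow_le_lintegral_deriv (fun s => h₁ s t) (by fun_prop) ht.ne m s
  have hs : ∀ᵐ s, ∀ t, ‖f (s, t)‖ₑ ^ (m + 1) ≤ Q s := by
    have hL' := hL
    rw [Measure.volume_eq_prod, lintegral_prod _ mf.aemeasurable] at hL'
    filter_upwards [ae_lt_top mf.lintegral_prod_right' hL'] with s hs t
    exact enorm_pow_le_lintegral_deriv (fun t => h₂ s t) (by fun_prop) hs.ne m t
  have bound : ∀ D : ℝ × ℝ → ℝ, Continuous D → ∫⁻ z, ‖D z‖ₑ ^ 2 ≤ N →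
      (∫⁻ z, ‖f z‖ₑ ^ m * ‖D z‖ₑ) ^ 2 ≤ X * N := by
    intro D hD hDN
    refine (lintegral_mul_sq_le (by fun_prop) (by fun_prop)).trans ?_
    simp_rw [← pow_mul, mul_comm m 2]
    gcongr
  have hPint : (∫⁻ t, P t) ^ 2 ≤ (m + 1 : ℕ) ^ 2 * (X * N) := by
    rw [hP, lintegral_const_mul _ m1.lintegral_prod_left', ← lintegral_prod_symm' _ m1,
      ← Measure.volume_eq_prod, mul_pow]
    gcongr
    exact bound D₁ hD₁ le_self_add
  have hQint : (∫⁻ s, Q s) ^ 2 ≤ (m + 1 : ℕ) ^ 2 * (X * N) := by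
    rw [hQ, lintegral_const_mul _ m2.lintegral_prod_right', ← lintegral_prod _ m2.aemeasurable,
      ← Measure.volume_eq_prod, mul_pow]
    gcongr
    exact bound D₂ hD₂ le_add_self
  have hQP : Measurable fun z : ℝ × ℝ => Q z.1 * P z.2 :=
    (hQm.comp measurable_fst).mul (hPm.comp measurable_snd)
  -- Gagliardo's trick: `|f|^(m+1)` is bounded both by a function of `t` alone and by one of `s`
  -- alone, so its square is bounded by a product whose integral factors.
  have hpt : ∫⁻ z, ‖f z‖ₑ ^ (2 * (m + 1)) ≤ (∫⁻ s, Q s) * ∫⁻ t, P t := by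
    rw [Measure.volume_eq_prod, ← lintegral_prod_mul hQm.aemeasurable hPm.aemeasurable,
      lintegral_prod _ (by fun_prop), lintegral_prod _ hQP.aemeasurable]
    refine lintegral_mono_ae ?_
    filter_upwards [hs] with s hs
    refine lintegral_mono_ae ?_
    filter_upwards [ht] with t ht
    rw [mul_comm 2, pow_mul, sq]
    exact mul_le_mul' (hs t) (ht s)
  refine hpt.trans ?_
  rw [mul_assoc]
  -- Cauchy–Schwarz controls the squares of the two factors, so squares are compared.
  refine (ENNReal.pow_le_pow_left_iff two_ne_zero).1 ?_
  rw [mul_pow, sq ((_ : ℝ≥0∞) * _)]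
  gcongr

/-- The Sobolev embedding of the plane into `L^{2m}`. -/
theorem lintegral_pow_le_plane (hD₁ : Continuous D₁) (hD₂ : Continuous D₂)
    (hf : Continuous f) (h₁ : ∀ s t, HasDerivAt (fun s => f (s, t)) (D₁ (s, t)) s)
    (h₂ : ∀ s t, HasDerivAt (fun t => f (s, t)) (D₂ (s, t)) t)
    (hL : ∫⁻ z, ‖f z‖ₑ ^ 2 ≠ ⊤) (m : ℕ) :
    ∫⁻ z, ‖f z‖ₑ ^ (2 * (m + 1)) ≤ (m + 1).factorial ^ 2 *
      ((∫⁻ z, ‖f z‖ₑ ^ 2) + ((∫⁻ z, ‖D₁ z‖ₑ ^ 2) + ∫⁻ z, ‖D₂ z‖ₑ ^ 2)) ^ (m + 1) := by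
  induction m with
  | zero => simp
  | succ m ih =>
    refine (lintegral_pow_succ_le_plane hD₁ hD₂ hf h₁ h₂ hL (m + 1)).trans ?_
    set S := (∫⁻ z, ‖f z‖ₑ ^ 2) + ((∫⁻ z, ‖D₁ z‖ₑ ^ 2) + ∫⁻ z, ‖D₂ z‖ₑ ^ 2) with hS
    calc _ ≤ ((m + 1 + 1 : ℕ) : ℝ≥0∞) ^ 2 * ((m + 1).factorial ^ 2 * S ^ (m + 1)) * S := by
          gcongr
          exact le_add_self
      _ = _ := by
          rw [Nat.factorial_succ (m + 1), Nat.cast_mul]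
          ring

/-- In the plane, the product of two truncated kernels is form bounded by the Sobolev norm. -/
theorem exists_lintegral_truncKernel_mul_truncKernel_mul_sq_le {c : ℝ} (hc : c < 1) :
    ∃ C : ℝ≥0∞, C ≠ ⊤ ∧ ∀ f D₁ D₂ : ℝ × ℝ → ℝ, Continuous D₁ → Continuous D₂ → Continuous f →
      (∀ s t, HasDerivAt (fun s => f (s, t)) (D₁ (s, t)) s) →
      (∀ s t, HasDerivAt (fun t => f (s, t)) (D₂ (s, t)) t) →
      ∫⁻ z, truncKernel c z.1 * truncKernel c z.2 * ‖f z‖ₑ ^ 2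
        ≤ C * ((∫⁻ z, ‖f z‖ₑ ^ 2) + ((∫⁻ z, ‖D₁ z‖ₑ ^ 2) + ∫⁻ z, ‖D₂ z‖ₑ ^ 2)) := by
  -- The condition `m > 1 / (1 - c)` says exactly that `c p < 1` for the exponent `p = m / (m - 1)`
  -- conjugate to `m`. The kernel is then in `L^p`, while `f²` in `L^m` is the embedding into
  -- `L^(2m)`; an integer `m` suits the iteration.
  obtain ⟨m, hm⟩ := exists_nat_gt (max 1 (1 / (1 - c)))
  have hm1 : (1 : ℝ) < m := (le_max_left _ _).trans_lt hm
  have hmc : c * (m / (m - 1)) < 1 := by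
    have h1 : 1 / (1 - c) < m := (le_max_right _ _).trans_lt hm
    rw [div_lt_iff₀ (by linarith)] at h1
    rw [← mul_div_assoc, div_lt_one (by linarith)]
    linarith
  have hpq : Real.HolderConjugate (m / (m - 1) : ℝ) m :=
    (Real.HolderConjugate.conjExponent hm1).symm
  obtain ⟨k, rfl⟩ : ∃ k, m = k + 1 := ⟨m - 1, by have : 1 < m := by exact_mod_cast hm1
                                                 omega⟩
  set p : ℝ := ((k + 1 : ℕ) : ℝ) / (((k + 1 : ℕ) : ℝ) - 1) with hp
  set V := ∫⁻ t, truncKernel (c * p) t with hV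
  have hVtop : V ≠ ⊤ := (lintegral_truncKernel_lt_top hmc).ne
  set q : ℝ := ((k + 1 : ℕ) : ℝ) with hq
  refine ⟨(V * V) ^ (1 / p) * (((k + 1).factorial : ℝ≥0∞) ^ 2) ^ (1 / q) + 1, ?_,
    fun f D₁ D₂ hD₁ hD₂ hf h₁ h₂ => ?_⟩
  · refine ENNReal.add_ne_top.2 ⟨ENNReal.mul_ne_top ?_ ?_, ENNReal.one_ne_top⟩
    · exact ENNReal.rpow_ne_top_of_nonneg (one_div_nonneg.2 hpq.nonneg)
        (ENNReal.mul_ne_top hVtop hVtop)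
    · exact ENNReal.rpow_ne_top_of_nonneg (one_div_nonneg.2 hpq.symm.nonneg)
        (ENNReal.pow_ne_top (ENNReal.natCast_ne_top _))
  set S := (∫⁻ z, ‖f z‖ₑ ^ 2) + ((∫⁻ z, ‖D₁ z‖ₑ ^ 2) + ∫⁻ z, ‖D₂ z‖ₑ ^ 2) with hS
  by_cases hL : ∫⁻ z, ‖f z‖ₑ ^ 2 = ⊤
  · rw [hS, hL, top_add, ENNReal.mul_top (by simp)]
    exact le_top
  have hvm : Measurable fun z : ℝ × ℝ => truncKernel c z.1 * truncKernel c z.2 :=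
    ((measurable_truncKernel c).comp measurable_fst).mul
      ((measurable_truncKernel c).comp measurable_snd)
  have hH := ENNReal.lintegral_mul_le_Lp_mul_Lq volume hpq hvm.aemeasurable
    (g := fun z => ‖f z‖ₑ ^ 2) (by fun_prop)
  have e1 : ∫⁻ z : ℝ × ℝ, (truncKernel c z.1 * truncKernel c z.2) ^ p = V * V := by
    simp_rw [ENNReal.mul_rpow_of_nonneg _ _ hpq.nonneg, truncKernel_rpow c hpq.pos]
    rw [Measure.volume_eq_prod, lintegral_prod_mul (measurable_truncKernel _).aemeasurable
      (measurable_truncKernel _).aemeasurable]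
  have e2 : ∫⁻ z, (‖f z‖ₑ ^ 2) ^ q ≤ (k + 1).factorial ^ 2 * S ^ (k + 1) := by
    refine le_trans (le_of_eq (lintegral_congr fun z => ?_))
      (lintegral_pow_le_plane hD₁ hD₂ hf h₁ h₂ hL k)
    rw [hq, ENNReal.rpow_natCast, ← pow_mul]
  calc ∫⁻ z, truncKernel c z.1 * truncKernel c z.2 * ‖f z‖ₑ ^ 2
      ≤ (∫⁻ z : ℝ × ℝ, (truncKernel c z.1 * truncKernel c z.2) ^ p) ^ (1 / p)
        * (∫⁻ z, (‖f z‖ₑ ^ 2) ^ q) ^ (1 / q) := hH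
    _ ≤ (V * V) ^ (1 / p) * ((k + 1).factorial ^ 2 * S ^ (k + 1)) ^ (1 / q) := by
        rw [e1]
        gcongr
    _ = (V * V) ^ (1 / p) * (((k + 1).factorial : ℝ≥0∞) ^ 2) ^ (1 / q) * S := by
        rw [ENNReal.mul_rpow_of_nonneg _ _ (one_div_nonneg.2 hpq.symm.nonneg), ← mul_assoc]
        congr 1
        rw [← ENNReal.rpow_natCast, ← ENNReal.rpow_mul, ← hq, mul_one_div_cancel hpq.symm.ne_zero,
          ENNReal.rpow_one]
    _ ≤ _ := by gcongr; exact le_self_add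

end Plane

/-! ### Reduction of the kernel to two singular factors -/

theorem exists_lt_one_bounds {ι : Type*} [Fintype ι] {α : ι → ℝ} (h1 : ∀ j, α j < 1)
    (h2 : ∑ j, α j < 2) : ∃ c, c < 1 ∧ (∀ j, α j ≤ c) ∧ ∑ j, α j ≤ 2 * c := by
  have e (a : ℝ) (ha : a < 1) : ∀ᶠ c in nhdsWithin (1 : ℝ) (Set.Iio 1), a ≤ c :=
    (eventually_nhdsWithin_of_eventually_nhds (eventually_gt_nhds ha)).mono fun _ h => h.le
  obtain ⟨c, hj, hs, (hc : c < 1)⟩ := ((Filter.eventually_all.2 fun j => e _ (h1 j)).and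
    ((e ((∑ j, α j) / 2) (by linarith)).and self_mem_nhdsWithin)).exists
  exact ⟨c, hc, hj, by linarith⟩

theorem max_one_inv_enorm_rpow_le (c t : ℝ) :
    (max 1 ‖t‖ₑ⁻¹) ^ c ≤ 1 + truncKernel c t := by
  by_cases h : t ∈ Set.Ioo (-1 : ℝ) 1
  · rw [truncKernel, Set.indicator_of_mem h, max_def]
    split_ifs
    · rw [ENNReal.inv_rpow, ← ENNReal.rpow_neg]
      exact le_add_self
    · rw [ENNReal.one_rpow]
      exact le_self_add
  · have ht : 1 ≤ ‖t‖ₑ := by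
      rw [Set.mem_Ioo, ← abs_lt, not_lt] at h
      rw [← ofReal_norm, Real.norm_eq_abs]
      exact ENNReal.one_le_ofReal.2 h
    rw [max_eq_left (ENNReal.inv_le_one.2 ht), ENNReal.one_rpow]
    exact le_self_add

/-- A product of powers is dominated by the product over its two largest bases. -/
theorem prod_rpow_le_of_sum_le {ι : Type*} [Fintype ι] [DecidableEq ι] {α : ι → ℝ} {c : ℝ}
    (hα0 : ∀ j, 0 ≤ α j) (hc : ∀ j, α j ≤ c) (hs : ∑ j, α j ≤ 2 * c) (u : ι → ℝ≥0∞)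
    (hu : ∀ j, 1 ≤ u j) :
    ∏ j, u j ^ α j ≤ 1 ∨ (∃ i, ∏ j, u j ^ α j ≤ u i ^ c) ∨
      ∃ i j, j ≠ i ∧ ∏ j, u j ^ α j ≤ u i ^ c * u j ^ c := by
  rcases isEmpty_or_nonempty ι with hι | hι
  · left; simp
  right
  obtain ⟨i, -, hi⟩ := Finset.exists_max_image Finset.univ u Finset.univ_nonempty
  rw [← Finset.mul_prod_erase _ _ (Finset.mem_univ i)]
  rcases (Finset.univ.erase i).eq_empty_or_nonempty with he | hne
  · left
    refine ⟨i, ?_⟩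
    rw [he, Finset.prod_empty, mul_one]
    exact ENNReal.rpow_le_rpow_of_exponent_le (hu i) (hc i)
  right
  obtain ⟨j, hj, hjmax⟩ := Finset.exists_max_image _ u hne
  refine ⟨i, j, Finset.ne_of_mem_erase hj, ?_⟩
  have hsum : α i + ∑ k ∈ Finset.univ.erase i, α k ≤ 2 * c := by
    rwa [Finset.add_sum_erase _ _ (Finset.mem_univ i)]
  have hci : 0 ≤ c - α i := sub_nonneg.2 (hc i)
  have hc0 : 0 ≤ c := (hα0 i).trans (hc i)
  have hpow : ∀ s : Finset ι, u j ^ (∑ k ∈ s, α k) = ∏ k ∈ s, u j ^ α k := by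
    intro s
    induction s using Finset.induction_on with
    | empty => simp
    | insert a s ha ih =>
      rw [Finset.sum_insert ha, Finset.prod_insert ha,
        ENNReal.rpow_add_of_nonneg _ _ (hα0 a) (Finset.sum_nonneg fun k _ => hα0 k), ih]
  -- With `u i ≥ u j` the two largest bases, every other base is raised to `u j`. The exponent of `u
  -- j` is then at most `2c - α i`, and its part `c - α i` is moved to the larger base `u i`,
  -- leaving exponent `c` on both.
  calc u i ^ α i * ∏ k ∈ Finset.univ.erase i, u k ^ α k
      ≤ u i ^ α i * ∏ k ∈ Finset.univ.erase i, u j ^ α k := by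
        gcongr with k hk
        · exact hα0 k
        · exact hjmax k hk
    _ = u i ^ α i * u j ^ ∑ k ∈ Finset.univ.erase i, α k := by rw [hpow]
    _ ≤ u i ^ α i * u j ^ (c - α i + c) := by
        gcongr
        · exact hu j
        · linarith
    _ = u i ^ α i * u j ^ (c - α i) * u j ^ c := by
        rw [ENNReal.rpow_add_of_nonneg _ _ hci hc0, mul_assoc]
    _ ≤ u i ^ α i * u i ^ (c - α i) * u j ^ c := by
        gcongr
        exact hi j (Finset.mem_univ j)
    _ = u i ^ c * u j ^ c := by
        rw [← ENNReal.rpow_add_of_nonneg _ _ (hα0 i) hci, add_sub_cancel]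

/-- The two dominant coordinates depend on `x`, so the bound sums over all candidates to have a
fixed form that can be integrated term by term. Each pair term is the expanded product of two
factors `1 + truncKernel c`; the coefficient 2 in the single sum is slack. -/
theorem prodKernel_le {d : ℕ} {α : Fin d → ℝ} {c : ℝ} (hα0 : ∀ j, 0 ≤ α j)
    (hc : ∀ j, α j ≤ c) (hs : ∑ j, α j ≤ 2 * c) (x : EuclideanSpace ℝ (Fin d)) :
    prodKernel α x ≤ 1 + ∑ i, 2 * truncKernel c (x i) +
      ∑ i, ∑ j ∈ Finset.univ.erase i,
        (1 + truncKernel c (x i) + truncKernel c (x j) + truncKernel c (x i) * truncKernel c (x j)) := by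
  set u : Fin d → ℝ≥0∞ := fun j => max 1 ‖x j‖ₑ⁻¹ with hu
  have hle : prodKernel α x ≤ ∏ j, u j ^ α j := by
    refine Finset.prod_le_prod' fun j _ => ?_
    rw [ENNReal.rpow_neg, ← ENNReal.inv_rpow]
    exact ENNReal.rpow_le_rpow (le_max_right _ _) (hα0 j)
  refine hle.trans ?_
  rcases prod_rpow_le_of_sum_le hα0 hc hs u (fun j => le_max_left _ _) with h | ⟨i, h⟩ | ⟨i, j, hij, h⟩
  · exact h.trans (by rw [add_assoc]; exact le_self_add)
  · refine (h.trans (max_one_inv_enorm_rpow_le c (x i))).trans (le_trans ?_ le_self_add)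
    gcongr
    refine le_trans ?_ (Finset.single_le_sum (f := fun i => 2 * truncKernel c (x i))
      (fun _ _ => zero_le) (Finset.mem_univ i))
    rw [two_mul]
    exact le_self_add
  · have hi := max_one_inv_enorm_rpow_le c (x i)
    have hj := max_one_inv_enorm_rpow_le c (x j)
    refine (h.trans (mul_le_mul' hi hj)).trans (le_trans ?_ le_add_self)
    refine le_trans (le_of_eq (by ring)) ((Finset.single_le_sum (f := fun j =>
      1 + truncKernel c (x i) + truncKernel c (x j) + truncKernel c (x i) * truncKernel c (x j))
      (fun _ _ => zero_le) (Finset.mem_erase.2 ⟨hij, Finset.mem_univ j⟩)).trans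
      (Finset.single_le_sum (f := fun i => ∑ j ∈ Finset.univ.erase i,
        (1 + truncKernel c (x i) + truncKernel c (x j) + truncKernel c (x i) * truncKernel c (x j)))
      (fun _ _ => zero_le) (Finset.mem_univ i)))

/-! ### Slicing along one or two coordinates -/

section Coordinates

variable {c : ℝ}

/-- The bound on the line holds on every slice parallel to the `i`-th axis, including those outside
`L²`, where its right side is infinite. Integrating over the other coordinates preserves it. -/
theorem exists_lintegral_truncKernel_coord_le (hc : c < 1) (d : ℕ) :
    ∃ C : ℝ≥0∞, C ≠ ⊤ ∧ ∀ (f : (Fin d → ℝ) → ℝ) (D : Fin d → (Fin d → ℝ) → ℝ), Continuous f →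
      (∀ j, Continuous (D j)) →
      (∀ x j, HasDerivAt (fun s => f (Function.update x j s)) (D j x) (x j)) → ∀ i,
      ∫⁻ x, truncKernel c (x i) * ‖f x‖ₑ ^ 2
        ≤ C * ((∫⁻ x, ‖f x‖ₑ ^ 2) + ∑ j, ∫⁻ x, ‖D j x‖ₑ ^ 2) := by
  obtain ⟨C, hC, h⟩ := exists_lintegral_truncKernel_mul_sq_le hc
  refine ⟨C, hC, fun f D hf hD hder i => ?_⟩
  have mv : Measurable fun x : Fin d → ℝ => truncKernel c (x i) :=
    (measurable_truncKernel c).comp (measurable_pi_apply i)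
  have mF : Measurable fun x => truncKernel c (x i) * ‖f x‖ₑ ^ 2 := mv.mul (by fun_prop)
  have mG : Measurable fun x => C * (‖f x‖ₑ ^ 2 + ‖D i x‖ₑ ^ 2) := by
    have := hD i
    fun_prop
  calc _ ≤ ∫⁻ x, C * (‖f x‖ₑ ^ 2 + ‖D i x‖ₑ ^ 2) := by
        refine lintegral_le_of_lmarginal_le {i} mF mG ?_
        simp_rw [lmarginal_singleton]
        intro x
        have hupd : Continuous fun s => Function.update x i s := by fun_prop
        have hfu := hf.comp hupd
        have hDu := (hD i).comp hupd
        simp only [Function.comp_def] at hfu hDu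
        have h1 := h (fun s => f (Function.update x i s)) (fun s => D i (Function.update x i s))
          (fun s => by simpa using hder (Function.update x i s) i) hDu
        simp only [Function.update_self]
        rwa [lintegral_const_mul' _ _ hC,
          lintegral_add_left hfu.measurable_enorm_sq]
    _ ≤ _ := by
        rw [lintegral_const_mul _ (by fun_prop), lintegral_add_left (by fun_prop)]
        gcongr
        exact Finset.single_le_sum (f := fun j => ∫⁻ x, ‖D j x‖ₑ ^ 2)
          (fun _ _ => zero_le) (Finset.mem_univ i)

/-- The same slicing with planes: the other coordinates are frozen and the planar bound is applied
to the remaining two. -/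
theorem exists_lintegral_truncKernel_coord_pair_le (hc : c < 1) (d : ℕ) :
    ∃ C : ℝ≥0∞, C ≠ ⊤ ∧ ∀ (f : (Fin d → ℝ) → ℝ) (D : Fin d → (Fin d → ℝ) → ℝ), Continuous f →
      (∀ j, Continuous (D j)) →
      (∀ x j, HasDerivAt (fun s => f (Function.update x j s)) (D j x) (x j)) → ∀ i j, j ≠ i →
      ∫⁻ x, truncKernel c (x i) * truncKernel c (x j) * ‖f x‖ₑ ^ 2
        ≤ C * ((∫⁻ x, ‖f x‖ₑ ^ 2) + ∑ j, ∫⁻ x, ‖D j x‖ₑ ^ 2) := by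
  obtain ⟨C, hC, h⟩ := exists_lintegral_truncKernel_mul_truncKernel_mul_sq_le hc
  refine ⟨C, hC, fun f D hf hD hder i j hij => ?_⟩
  have mv (i) : Measurable fun x : Fin d → ℝ => truncKernel c (x i) :=
    (measurable_truncKernel c).comp (measurable_pi_apply i)
  have mF : Measurable fun x => truncKernel c (x i) * truncKernel c (x j) * ‖f x‖ₑ ^ 2 :=
    ((mv i).mul (mv j)).mul (by fun_prop)
  have hDi := hD i
  have hDj := hD j
  have mG : Measurable fun x => C * (‖f x‖ₑ ^ 2 + (‖D i x‖ₑ ^ 2 + ‖D j x‖ₑ ^ 2)) := by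
    fun_prop
  calc _ ≤ ∫⁻ x, C * (‖f x‖ₑ ^ 2 + (‖D i x‖ₑ ^ 2 + ‖D j x‖ₑ ^ 2)) := by
        refine lintegral_le_of_lmarginal_le {i, j} mF mG fun x => ?_
        rw [lmarginal_insert _ mF (by simpa using hij.symm),
          lmarginal_insert _ mG (by simpa using hij.symm)]
        simp_rw [lmarginal_singleton]
        have hupd : Continuous fun z : ℝ × ℝ =>
          Function.update (Function.update x i z.1) j z.2 := by fun_prop
        have hfu := hf.comp hupd
        have hDiu := hDi.comp hupd
        have hDju := hDj.comp hupd
        simp only [Function.comp_def] at hfu hDiu hDju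
        have h1 := h (fun z => f (Function.update (Function.update x i z.1) j z.2))
          (fun z => D i (Function.update (Function.update x i z.1) j z.2))
          (fun z => D j (Function.update (Function.update x i z.1) j z.2))
          hDiu hDju hfu
          (fun s t => by
            simp only [Function.update_comm hij.symm]
            simpa using hder (Function.update (Function.update x j t) i s) i)
          (fun s t => by
            simpa using hder (Function.update (Function.update x i s) j t) j)
        have mF' := mF.comp hupd.measurable
        have mG' := mG.comp hupd.measurable
        rw [← lintegral_add_left hDiu.measurable_enorm_sq,
          ← lintegral_add_left hfu.measurable_enorm_sq, ← lintegral_const_mul' _ _ hC] at h1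
        -- Tonelli identifies the iterated marginal over `{i, j}` with the integral over `ℝ × ℝ` in
        -- the planar bound.
        have e1 := lintegral_prod (μ := (volume : Measure ℝ)) (ν := (volume : Measure ℝ)) _
          mF'.aemeasurable
        have e2 := lintegral_prod (μ := (volume : Measure ℝ)) (ν := (volume : Measure ℝ)) _
          mG'.aemeasurable
        simp only [Function.comp_apply, ← Measure.volume_eq_prod] at e1 e2
        rw [← e1, ← e2]
        simpa [Function.update_of_ne hij.symm] using h1
    _ ≤ _ := by
        rw [lintegral_const_mul _ (by fun_prop), lintegral_add_left (by fun_prop),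
          lintegral_add_left (by fun_prop)]
        gcongr
        rw [← Finset.sum_pair (f := fun j => ∫⁻ x, ‖D j x‖ₑ ^ 2) hij.symm]
        exact Finset.sum_le_sum_of_subset (Finset.subset_univ _)

end Coordinates

/-! ### The form bound for smooth functions and its scaling -/

section Euclidean

variable {d : ℕ}

theorem measurable_prodKernel (α : Fin d → ℝ) : Measurable (prodKernel α) := by
  unfold prodKernel
  fun_prop

theorem lintegral_euclideanSpace_eq (F : EuclideanSpace ℝ (Fin d) → ℝ≥0∞) :
    ∫⁻ x, F x = ∫⁻ y : Fin d → ℝ, F (WithLp.toLp 2 y) :=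
  ((PiLp.volume_preserving_toLp (Fin d)).lintegral_comp_emb
    (MeasurableEquiv.toLp 2 (Fin d → ℝ)).measurableEmbedding F).symm

theorem hasDerivAt_comp_toLp_update {f : EuclideanSpace ℝ (Fin d) → ℝ} (hf : ContDiff ℝ 1 f)
    (x : Fin d → ℝ) (j : Fin d) :
    HasDerivAt (fun s => f (WithLp.toLp 2 (Function.update x j s)))
      (fderiv ℝ f (WithLp.toLp 2 x) (EuclideanSpace.single j 1)) (x j) := by
  have h1 : HasDerivAt (fun s => (WithLp.toLp 2 (Function.update x j s) : EuclideanSpace ℝ (Fin d)))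
      (EuclideanSpace.single j 1) (x j) :=
    ((PiLp.continuousLinearEquiv 2 ℝ fun _ : Fin d => ℝ).symm.toContinuousLinearMap.hasFDerivAt
      (x := Function.update x j (x j))).comp_hasDerivAt (x j) (hasDerivAt_update x j (x j))
  have h2 : HasFDerivAt f (fderiv ℝ f (WithLp.toLp 2 x))
      (WithLp.toLp 2 (Function.update x j (x j))) := by
    rw [Function.update_eq_self]
    exact (hf.differentiable one_ne_zero _).hasFDerivAt
  exact h2.comp_hasDerivAt (x j) h1

/-- The product kernel is form bounded by the Sobolev norm, for smooth functions. -/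
theorem exists_lintegral_prodKernel_mul_sq_le {α : Fin d → ℝ} (hα0 : ∀ j, 0 ≤ α j)
    (hα1 : ∀ j, α j < 1) (hα2 : ∑ j, α j < 2) :
    ∃ C : ℝ≥0∞, C ≠ ⊤ ∧ ∀ f : EuclideanSpace ℝ (Fin d) → ℝ, ContDiff ℝ 1 f →
      ∫⁻ x, prodKernel α x * ‖f x‖ₑ ^ 2 ≤ C * ((∫⁻ x, ‖f x‖ₑ ^ 2) +
        ∑ j, ∫⁻ x, ‖fderiv ℝ f x (EuclideanSpace.single j 1)‖ₑ ^ 2) := by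
  obtain ⟨c, hc1, hcα, hcs⟩ := exists_lt_one_bounds hα1 hα2
  obtain ⟨C₁, hC₁, h₁⟩ := exists_lintegral_truncKernel_coord_le hc1 d
  obtain ⟨C₂, hC₂, h₂⟩ := exists_lintegral_truncKernel_coord_pair_le hc1 d
  refine ⟨1 + ∑ i : Fin d, 2 * C₁ + ∑ i : Fin d, ∑ j ∈ Finset.univ.erase i, (1 + C₁ + C₁ + C₂), ?_,
    fun f hf => ?_⟩
  · simp [ENNReal.mul_eq_top, hC₁, hC₂]
  set S := (∫⁻ x, ‖f x‖ₑ ^ 2) +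
    ∑ j, ∫⁻ x, ‖fderiv ℝ f x (EuclideanSpace.single j 1)‖ₑ ^ 2 with hS
  have hfc : Continuous f := hf.continuous
  have hto : Continuous fun y : Fin d → ℝ => (WithLp.toLp 2 y : EuclideanSpace ℝ (Fin d)) :=
    (PiLp.continuousLinearEquiv 2 ℝ fun _ : Fin d => ℝ).symm.continuous
  have hDc (j : Fin d) : Continuous fun x => fderiv ℝ f x (EuclideanSpace.single j 1) :=
    (hf.continuous_fderiv one_ne_zero).clm_apply continuous_const
  have mv (i : Fin d) : Measurable fun x : EuclideanSpace ℝ (Fin d) => truncKernel c (x i) :=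
    (measurable_truncKernel c).comp (by fun_prop)
  have mf : Measurable fun x => ‖f x‖ₑ ^ 2 := by fun_prop
  have b₁ (i : Fin d) : ∫⁻ x, truncKernel c (x i) * ‖f x‖ₑ ^ 2 ≤ C₁ * S := by
    simp_rw [hS, lintegral_euclideanSpace_eq]
    exact h₁ _ (fun j y => fderiv ℝ f (WithLp.toLp 2 y) (EuclideanSpace.single j 1))
      (hfc.comp hto) (fun j => (hDc j).comp hto) (hasDerivAt_comp_toLp_update hf) i
  have b₂ (i j : Fin d) (hij : j ≠ i) :
      ∫⁻ x, truncKernel c (x i) * truncKernel c (x j) * ‖f x‖ₑ ^ 2 ≤ C₂ * S := by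
    simp_rw [hS, lintegral_euclideanSpace_eq]
    exact h₂ _ (fun j y => fderiv ℝ f (WithLp.toLp 2 y) (EuclideanSpace.single j 1))
      (hfc.comp hto) (fun j => (hDc j).comp hto) (hasDerivAt_comp_toLp_update hf) i j hij
  have b₀ : ∫⁻ x, ‖f x‖ₑ ^ 2 ≤ S := le_self_add
  have m₁ (i : Fin d) : Measurable fun x : EuclideanSpace ℝ (Fin d) =>
    truncKernel c (x i) * ‖f x‖ₑ ^ 2 := (mv i).mul mf
  have m₂ (i j : Fin d) : Measurable fun x : EuclideanSpace ℝ (Fin d) =>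
    truncKernel c (x i) * truncKernel c (x j) * ‖f x‖ₑ ^ 2 := ((mv i).mul (mv j)).mul mf
  calc ∫⁻ x, prodKernel α x * ‖f x‖ₑ ^ 2
      ≤ ∫⁻ x, (‖f x‖ₑ ^ 2 + ∑ i, 2 * (truncKernel c (x i) * ‖f x‖ₑ ^ 2) +
          ∑ i, ∑ j ∈ Finset.univ.erase i, (‖f x‖ₑ ^ 2 + truncKernel c (x i) * ‖f x‖ₑ ^ 2
            + truncKernel c (x j) * ‖f x‖ₑ ^ 2
            + truncKernel c (x i) * truncKernel c (x j) * ‖f x‖ₑ ^ 2)) := by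
        refine lintegral_mono fun x => ?_
        refine (mul_le_mul_left (prodKernel_le hα0 hcα hcs x) _).trans (le_of_eq ?_)
        simp only [add_mul, Finset.sum_mul, one_mul, mul_assoc]
    _ = (∫⁻ x, ‖f x‖ₑ ^ 2) + ∑ i, 2 * (∫⁻ x, truncKernel c (x i) * ‖f x‖ₑ ^ 2) +
          ∑ i, ∑ j ∈ Finset.univ.erase i, ((∫⁻ x, ‖f x‖ₑ ^ 2)
            + (∫⁻ x, truncKernel c (x i) * ‖f x‖ₑ ^ 2)
            + (∫⁻ x, truncKernel c (x j) * ‖f x‖ₑ ^ 2)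
            + ∫⁻ x, truncKernel c (x i) * truncKernel c (x j) * ‖f x‖ₑ ^ 2) := by
        rw [lintegral_add_left (by fun_prop), lintegral_add_left (by fun_prop),
          lintegral_finsetSum _ (by fun_prop), lintegral_finsetSum _ (by fun_prop)]
        congr 1
        · congr 1
          exact Finset.sum_congr rfl fun i _ => lintegral_const_mul _ (m₁ i)
        · refine Finset.sum_congr rfl fun i _ => ?_
          rw [lintegral_finsetSum _ (by fun_prop)]
          refine Finset.sum_congr rfl fun j _ => ?_
          rw [lintegral_add_left (by fun_prop), lintegral_add_left (by fun_prop),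
            lintegral_add_left (by fun_prop)]
    _ ≤ S + ∑ i : Fin d, 2 * (C₁ * S) +
          ∑ i : Fin d, ∑ j ∈ Finset.univ.erase i, (S + C₁ * S + C₁ * S + C₂ * S) := by
        gcongr with i _ i _ j hj
        · exact b₁ i
        · exact b₁ i
        · exact b₁ j
        · exact b₂ i j (Finset.ne_of_mem_erase hj)
    _ = _ := by simp only [add_mul, Finset.sum_mul, one_mul, mul_assoc]

theorem lintegral_comp_smul_add {δ : ℝ} (hδ : 0 < δ) (y : EuclideanSpace ℝ (Fin d))
    (F : EuclideanSpace ℝ (Fin d) → ℝ≥0∞) :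
    ∫⁻ x, F (δ • x + y) = ENNReal.ofReal (δ ^ d)⁻¹ * ∫⁻ x, F x := by
  have h := lintegral_map_equiv (μ := volume) (fun x => F (x + y))
    (Homeomorph.smulOfNeZero δ hδ.ne').toMeasurableEquiv
  have h' : ∫⁻ x, F (δ • x + y) = ∫⁻ x, F (x + y) ∂(Measure.map (δ • ·) volume) := h.symm
  rw [h', Measure.map_addHaar_smul _ hδ.ne', finrank_euclideanSpace_fin, abs_of_pos (by positivity),
    lintegral_smul_measure, lintegral_add_right_eq_self F y, smul_eq_mul]

theorem prodKernel_smul (α : Fin d → ℝ) {δ : ℝ} (hδ : 0 < δ) (x : EuclideanSpace ℝ (Fin d)) :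
    prodKernel α (δ • x) = ENNReal.ofReal (δ ^ (-∑ j, α j)) * prodKernel α x := by
  unfold prodKernel
  rw [← Finset.sum_neg_distrib, Real.rpow_sum_of_pos hδ, ENNReal.ofReal_prod_of_nonneg
    (fun j _ => (Real.rpow_pos_of_pos hδ _).le), ← Finset.prod_mul_distrib]
  refine Finset.prod_congr rfl fun j _ => ?_
  rw [PiLp.smul_apply, smul_eq_mul, enorm_mul, ENNReal.mul_rpow_of_ne_top enorm_ne_top enorm_ne_top,
    Real.enorm_eq_ofReal hδ.le, ENNReal.ofReal_rpow_of_pos hδ]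

/-- The form bound of the product kernel at scale `δ`, centred at an arbitrary point. -/
theorem lintegral_prodKernel_sub_mul_sq_le {α : Fin d → ℝ} {C : ℝ≥0∞}
    (hC : ∀ f : EuclideanSpace ℝ (Fin d) → ℝ, ContDiff ℝ 1 f →
      ∫⁻ x, prodKernel α x * ‖f x‖ₑ ^ 2 ≤ C * ((∫⁻ x, ‖f x‖ₑ ^ 2) +
        ∑ j, ∫⁻ x, ‖fderiv ℝ f x (EuclideanSpace.single j 1)‖ₑ ^ 2))
    {f : EuclideanSpace ℝ (Fin d) → ℝ} (hf : ContDiff ℝ 1 f) {δ : ℝ} (hδ : 0 < δ)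
    (y : EuclideanSpace ℝ (Fin d)) :
    ∫⁻ x, prodKernel α (x - y) * ‖f x‖ₑ ^ 2 ≤
      C * (ENNReal.ofReal (δ ^ (-∑ j, α j)) * (∫⁻ x, ‖f x‖ₑ ^ 2) +
        ENNReal.ofReal (δ ^ (2 - ∑ j, α j)) *
          ∑ j, ∫⁻ x, ‖fderiv ℝ f x (EuclideanSpace.single j 1)‖ₑ ^ 2) := by
  -- The unit-scale bound is applied to the rescaled, translated function. The Jacobian `δ^(-d)`
  -- occurs on both sides and cancels; the kernel contributes `δ^(-α)` and the squared gradient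
  -- `δ²`.
  have hg : ContDiff ℝ 1 fun x => f (δ • x + y) := by fun_prop
  have hder (x v : EuclideanSpace ℝ (Fin d)) :
      fderiv ℝ (fun x => f (δ • x + y)) x v = δ * fderiv ℝ f (δ • x + y) v := by
    have h1 : HasFDerivAt (fun x : EuclideanSpace ℝ (Fin d) => δ • x + y)
        (δ • ContinuousLinearMap.id ℝ _) x := ((hasFDerivAt_id x).const_smul δ).add_const y
    have h2 := (hf.differentiable one_ne_zero (δ • x + y)).hasFDerivAt.comp x h1
    rw [show (fun x => f (δ • x + y)) = f ∘ fun x => δ • x + y from rfl, h2.fderiv]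
    simp
  have hK : ∫⁻ x, prodKernel α (x - y) * ‖f x‖ₑ ^ 2 = ENNReal.ofReal (δ ^ d) *
      (ENNReal.ofReal (δ ^ (-∑ j, α j)) * ∫⁻ x, prodKernel α x * ‖f (δ • x + y)‖ₑ ^ 2) := by
    have h := lintegral_comp_smul_add hδ y fun x => prodKernel α (x - y) * ‖f x‖ₑ ^ 2
    simp only [add_sub_cancel_right, prodKernel_smul α hδ, mul_assoc] at h
    rw [lintegral_const_mul' _ _ ENNReal.ofReal_ne_top] at h
    rw [h, ← mul_assoc, ← ENNReal.ofReal_mul (by positivity), mul_inv_cancel₀ (by positivity),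
      ENNReal.ofReal_one, one_mul]
  have hc : ENNReal.ofReal (δ ^ d) * ENNReal.ofReal (δ ^ d)⁻¹ = 1 := by
    rw [← ENNReal.ofReal_mul (by positivity), mul_inv_cancel₀ (by positivity), ENNReal.ofReal_one]
  have hD (j : Fin d) : ∫⁻ x, ‖fderiv ℝ (fun x => f (δ • x + y)) x (EuclideanSpace.single j 1)‖ₑ ^ 2
      = ENNReal.ofReal (δ ^ (2 : ℝ)) * (ENNReal.ofReal (δ ^ d)⁻¹ *
        ∫⁻ x, ‖fderiv ℝ f x (EuclideanSpace.single j 1)‖ₑ ^ 2) := by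
    simp_rw [hder, enorm_mul, mul_pow]
    rw [lintegral_const_mul' _ _ (by finiteness), lintegral_comp_smul_add hδ y
      fun x => ‖fderiv ℝ f x (EuclideanSpace.single j 1)‖ₑ ^ 2, Real.enorm_eq_ofReal hδ.le,
      ← ENNReal.ofReal_pow hδ.le, Real.rpow_two]
  rw [hK]
  refine (mul_le_mul_right (mul_le_mul_right (hC _ hg) _) _).trans (le_of_eq ?_)
  rw [lintegral_comp_smul_add hδ y fun x => ‖f x‖ₑ ^ 2]
  simp_rw [hD, ← Finset.mul_sum]
  rw [sub_eq_add_neg, Real.rpow_add hδ, ENNReal.ofReal_mul (by positivity)]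
  generalize ENNReal.ofReal (δ ^ (-∑ j, α j)) = a at *
  generalize ENNReal.ofReal (δ ^ (2 : ℝ)) = b at *
  generalize (∑ j, ∫⁻ x, ‖fderiv ℝ f x (EuclideanSpace.single j 1)‖ₑ ^ 2) = B at *
  generalize (∫⁻ x, ‖f x‖ₑ ^ 2) = A at *
  generalize ENNReal.ofReal (δ ^ d) = p at *
  generalize ENNReal.ofReal (δ ^ d)⁻¹ = q at *
  calc p * (a * (C * (q * A + b * (q * B)))) = p * q * (C * (a * A + b * a * B)) := by ring
    _ = _ := by rw [hc, one_mul]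

end Euclidean

/-! ### Approximation by mollified functions -/

section Mollification

open ContinuousLinearMap

variable {d : ℕ}

local notation "E" => EuclideanSpace ℝ (Fin d)

theorem lintegral_enorm_normed (φ : ContDiffBump (0 : E)) : ∫⁻ x, ‖φ.normed volume x‖ₑ = 1 := by
  simp_rw [Real.enorm_eq_ofReal (φ.nonneg_normed _)]
  rw [← ofReal_integral_eq_lintegral_ofReal φ.integrable_normed
    (Filter.Eventually.of_forall φ.nonneg_normed), φ.integral_normed, ENNReal.ofReal_one]

/-- Convolution with a normed bump function is a contraction of `L²`. -/
theorem lintegral_sq_convolution_normed_le (φ : ContDiffBump (0 : E)) {h : E → ℝ}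
    (hh : AEStronglyMeasurable h volume) :
    ∫⁻ x, ‖(convolution (φ.normed volume) h (lsmul ℝ ℝ) volume) x‖ₑ ^ 2 ≤ ∫⁻ x, ‖h x‖ₑ ^ 2 := by
  -- Both sides depend only on the almost-everywhere class of `h`.
  wlog hm : Measurable h generalizing h
  · have h1 := this (h := hh.mk h) hh.stronglyMeasurable_mk.aestronglyMeasurable
      hh.stronglyMeasurable_mk.measurable
    rw [← convolution_congr (lsmul ℝ ℝ) (ae_eq_refl _) hh.ae_eq_mk] at h1
    refine h1.trans (le_of_eq (lintegral_congr_ae ?_))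
    filter_upwards [hh.ae_eq_mk] with x hx
    rw [hx]
  set w : E → ℝ≥0∞ := fun t => ‖φ.normed volume t‖ₑ with hw
  have hwm : Measurable w := φ.continuous_normed.measurable.enorm
  have hpt (x : E) : ‖(convolution (φ.normed volume) h (lsmul ℝ ℝ) volume) x‖ₑ ^ 2
      ≤ ∫⁻ t, w t * ‖h (x - t)‖ₑ ^ 2 := by
    have hHm : Measurable fun t => ‖h (x - t)‖ₑ := by fun_prop
    calc _ ≤ (∫⁻ t, w t * ‖h (x - t)‖ₑ) ^ 2 := by
          gcongr
          refine (enorm_integral_le_lintegral_enorm _).trans (le_of_eq (lintegral_congr fun t => ?_))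
          rw [lsmul_apply, smul_eq_mul, enorm_mul]
      -- The mollifier is the density of a probability measure, so Cauchy–Schwarz against the
      -- constant 1 moves the square inside without loss.
      _ = (∫⁻ t, 1 * ‖h (x - t)‖ₑ ∂(volume.withDensity w)) ^ 2 := by
          simp_rw [one_mul]
          rw [lintegral_withDensity_eq_lintegral_mul _ hwm hHm]
          rfl
      _ ≤ (∫⁻ _, 1 ^ 2 ∂(volume.withDensity w)) *
            ∫⁻ t, ‖h (x - t)‖ₑ ^ 2 ∂(volume.withDensity w) :=
          lintegral_mul_sq_le aemeasurable_const hHm.aemeasurable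
      _ = _ := by
          rw [lintegral_withDensity_eq_lintegral_mul _ hwm (hHm.pow_const 2)]
          simp [hw, lintegral_enorm_normed]
  calc _ ≤ ∫⁻ x, ∫⁻ t, w t * ‖h (x - t)‖ₑ ^ 2 := lintegral_mono hpt
    _ = ∫⁻ t, ∫⁻ x, w t * ‖h (x - t)‖ₑ ^ 2 :=
        lintegral_lintegral_swap (Measurable.aemeasurable (by unfold Function.uncurry; fun_prop))
    _ = ∫⁻ t, w t * ∫⁻ x, ‖h x‖ₑ ^ 2 := by
        refine lintegral_congr fun t => ?_
        rw [lintegral_const_mul' _ _ (by simp [hw]),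
          lintegral_sub_right_eq_self (fun x => ‖h x‖ₑ ^ 2) t]
    _ = _ := by rw [lintegral_mul_const _ hwm, lintegral_enorm_normed, one_mul]

/-- The derivative of a mollified function is the mollified weak derivative. -/
theorem HasWeakGradient.fderiv_convolution_normed {f : E → ℝ} {G : E → E}
    (hG : HasWeakGradient f G) (φ : ContDiffBump (0 : E)) (x : E) (j : Fin d) :
    fderiv ℝ (convolution (φ.normed volume) f (lsmul ℝ ℝ) volume) x (EuclideanSpace.single j 1)
      = (convolution (φ.normed volume) (fun x => G x j) (lsmul ℝ ℝ) volume) x := by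
  set ρ := φ.normed volume with hρ
  have hρc : HasCompactSupport ρ := φ.hasCompactSupport_normed
  have hρs : ContDiff ℝ ∞ ρ := φ.contDiff_normed
  have hρ1 : ContDiff ℝ 1 ρ := φ.contDiff_normed
  have h1 := hρc.hasFDerivAt_convolution_right (lsmul ℝ ℝ).flip hG.locallyIntegrable hρ1 x
  rw [convolution_flip] at h1
  rw [h1.fderiv, convolution_precompR_apply _ hG.locallyIntegrable (hρc.fderiv ℝ)
    (hρ1.continuous_fderiv one_ne_zero)]
  have hsub (t : E) : HasFDerivAt (fun t => x - t) (-ContinuousLinearMap.id ℝ E) t :=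
    (hasFDerivAt_id t).const_sub x
  -- The test function is the reflected mollifier `t ↦ ρ (x - t)`; the sign from the reflection
  -- cancels the one in the definition of the weak gradient.
  have h2 := hG.integral_eq (fun t => ρ (x - t)) (hρs.comp (contDiff_const.sub contDiff_id))
    (hρc.comp_homeomorph (Homeomorph.subLeft x)) j
  have h3 (t : E) : fderiv ℝ (fun t => ρ (x - t)) t (EuclideanSpace.single j 1)
      = - fderiv ℝ ρ (x - t) (EuclideanSpace.single j 1) := by
    have := ((hρ1.differentiable one_ne_zero (x - t)).hasFDerivAt.comp t (hsub t)).fderiv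
    rw [show (fun t => ρ (x - t)) = ρ ∘ fun t => x - t from rfl, this]
    simp
  simp_rw [h3, mul_neg, integral_neg, neg_inj] at h2
  rw [convolution_def, convolution_eq_swap]
  simp only [flip_apply, lsmul_apply, smul_eq_mul]
  simp_rw [mul_comm (fderiv ℝ ρ _ _), mul_comm (ρ _)]
  exact h2

theorem enorm_sq_eq_sum (v : E) : ‖v‖ₑ ^ 2 = ∑ j, ‖v j‖ₑ ^ 2 := by
  simp_rw [← ofReal_norm, ← ENNReal.ofReal_pow (norm_nonneg _)]
  rw [EuclideanSpace.norm_sq_eq, ENNReal.ofReal_sum_of_nonneg fun _ _ => by positivity]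

/-- Meyers–Serrin type approximation of a function with a weak gradient. -/
theorem HasWeakGradient.exists_contDiff_approx {f : E → ℝ} {G : E → E}
    (hG : HasWeakGradient f G) :
    ∃ F : ℕ → E → ℝ, (∀ n, ContDiff ℝ 1 (F n)) ∧
      (∀ᵐ x, Filter.Tendsto (fun n => F n x) Filter.atTop (nhds (f x))) ∧
      (∀ n, ∫⁻ x, ‖F n x‖ₑ ^ 2 ≤ ∫⁻ x, ‖f x‖ₑ ^ 2) ∧
      ∀ n, ∑ j, ∫⁻ x, ‖fderiv ℝ (F n) x (EuclideanSpace.single j 1)‖ₑ ^ 2 ≤ ∫⁻ x, ‖G x‖ₑ ^ 2 := by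
  let φ : ℕ → ContDiffBump (0 : E) := fun n =>
    { rIn := 1 / (n + 1)
      rOut := 2 * (1 / (n + 1))
      rIn_pos := by positivity
      rIn_lt_rOut := by linarith [show (0 : ℝ) < 1 / (n + 1) by positivity] }
  have hGm : AEStronglyMeasurable G volume := hG.locallyIntegrable_grad.aestronglyMeasurable
  have hGj (j : Fin d) : AEStronglyMeasurable (fun x => G x j) volume :=
    (EuclideanSpace.proj (𝕜 := ℝ) j).continuous.comp_aestronglyMeasurable hGm
  refine ⟨fun n => convolution ((φ n).normed volume) f (lsmul ℝ ℝ) volume, fun n => ?_, ?_,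
    fun n => ?_, fun n => ?_⟩
  · exact HasCompactSupport.contDiff_convolution_left (n := 1) _ (φ n).hasCompactSupport_normed
      (φ n).contDiff_normed hG.locallyIntegrable
  -- Almost-everywhere convergence is Lebesgue differentiation, which needs a bounded ratio of outer
  -- to inner radius; here it is 2. With the norm bounds this suffices for Fatou, so norm
  -- convergence is not needed.
  · refine ContDiffBump.ae_convolution_tendsto_right_of_locallyIntegrable (K := 2) ?_
      (Filter.Eventually.of_forall fun n => le_rfl) hG.locallyIntegrable
    simpa [φ] using (tendsto_one_div_add_atTop_nhds_zero_nat (𝕜 := ℝ)).const_mul 2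
  · exact lintegral_sq_convolution_normed_le _ hG.locallyIntegrable.aestronglyMeasurable
  · simp_rw [enorm_sq_eq_sum (G _)]
    rw [lintegral_finsetSum' _ fun j _ => (hGj j).enorm.pow_const 2]
    refine Finset.sum_le_sum fun j _ => ?_
    simp_rw [hG.fderiv_convolution_normed]
    exact lintegral_sq_convolution_normed_le _ (hGj j)

end Mollification

/-! ### Extension to Sobolev functions and choice of scale -/

section FormBound

variable {d : ℕ}

theorem lintegral_enorm_sq_eq_eLpNorm {X F : Type*} [MeasurableSpace X] {μ : Measure X}
    [NormedAddCommGroup F] (f : X → F) : ∫⁻ x, ‖f x‖ₑ ^ 2 ∂μ = eLpNorm f 2 μ ^ 2 := by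
  have h := eLpNorm_nnreal_pow_eq_lintegral (f := f) (μ := μ) (p := 2) two_ne_zero
  simp only [NNReal.coe_ofNat, ENNReal.rpow_ofNat, ENNReal.coe_ofNat] at h
  exact h.symm

/-- The form bound of the product kernel on `W^{1,2}`, at every scale and every centre. -/
theorem exists_lintegral_prodKernel_sub_le_of_mem_sobolevW12 {α : Fin d → ℝ}
    (hα0 : ∀ j, 0 ≤ α j) (hα1 : ∀ j, α j < 1) (hα2 : ∑ j, α j < 2) :
    ∃ C : ℝ, 0 < C ∧ ∀ f ∈ sobolevW12 d, ∀ δ : ℝ, 0 < δ → ∀ y : EuclideanSpace ℝ (Fin d),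
      ∫⁻ x, prodKernel α (x - y) * ‖f x‖ₑ ^ 2 ≤
        ENNReal.ofReal C * (ENNReal.ofReal (δ ^ (-∑ j, α j)) * eLpNorm f 2 volume ^ 2 +
          ENNReal.ofReal (δ ^ (2 - ∑ j, α j)) * eLpNorm (weakGrad f) 2 volume ^ 2) := by
  obtain ⟨C, hCtop, hC⟩ := exists_lintegral_prodKernel_mul_sq_le hα0 hα1 hα2
  refine ⟨C.toReal + 1, by positivity, fun f hf δ hδ y => ?_⟩
  have hCle : C ≤ ENNReal.ofReal (C.toReal + 1) := by
    rw [ENNReal.le_ofReal_iff_toReal_le hCtop (by positivity)]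
    linarith
  obtain ⟨F, hF1, hFlim, hFf, hFG⟩ := (weakGrad_spec hf).1.exists_contDiff_approx
  simp_rw [← lintegral_enorm_sq_eq_eLpNorm]
  set B := ENNReal.ofReal (C.toReal + 1) * (ENNReal.ofReal (δ ^ (-∑ j, α j)) * (∫⁻ x, ‖f x‖ₑ ^ 2) +
    ENNReal.ofReal (δ ^ (2 - ∑ j, α j)) * ∫⁻ x, ‖weakGrad f x‖ₑ ^ 2) with hB
  have hbound (n : ℕ) : ∫⁻ x, prodKernel α (x - y) * ‖F n x‖ₑ ^ 2 ≤ B := by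
    refine (lintegral_prodKernel_sub_mul_sq_le hC (hF1 n) hδ y).trans ?_
    rw [hB]
    exact mul_le_mul' hCle (add_le_add (mul_le_mul_right (hFf n) _)
      (mul_le_mul_right (hFG n) _))
  have hmeas (n : ℕ) : Measurable fun x => prodKernel α (x - y) * ‖F n x‖ₑ ^ 2 :=
    ((measurable_prodKernel α).comp (measurable_sub_const y)).mul
      (hF1 n).continuous.measurable_enorm_sq
  calc ∫⁻ x, prodKernel α (x - y) * ‖f x‖ₑ ^ 2
      ≤ ∫⁻ x, Filter.liminf (fun n => prodKernel α (x - y) * ‖F n x‖ₑ ^ 2) Filter.atTop := by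
        refine lintegral_mono_ae ?_
        filter_upwards [hFlim] with x hx
        -- Where `f x = 0` the kernel may be infinite and multiplication by it discontinuous, but
        -- the left side is then zero.
        rcases eq_or_ne (f x) 0 with h0 | h0
        · simp [h0]
        · have h1 : Filter.Tendsto (fun n => ‖F n x‖ₑ ^ 2) Filter.atTop (nhds (‖f x‖ₑ ^ 2)) :=
            ((ENNReal.continuous_pow 2).tendsto _).comp ((continuous_enorm.tendsto _).comp hx)
          exact (ENNReal.Tendsto.const_mul h1 (Or.inl (by simpa using h0))).liminf_eq.ge
    _ ≤ Filter.liminf (fun n => ∫⁻ x, prodKernel α (x - y) * ‖F n x‖ₑ ^ 2) Filter.atTop :=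
        lintegral_liminf_le hmeas
    _ ≤ B := (Filter.liminf_le_liminf (Filter.Eventually.of_forall hbound)).trans_eq
        (Filter.liminf_const _)

/-- Optimising a two-term bound over the scale. -/
theorem le_ofReal_of_forall_scale_le {X : ℝ≥0∞} {C a b s : ℝ} (ha : 0 ≤ a) (hb : 0 ≤ b)
    (hC : 0 ≤ C) (hs0 : 0 ≤ s) (hs2 : s < 2)
    (h : ∀ δ : ℝ, 0 < δ → X ≤ ENNReal.ofReal (C * (δ ^ (-s) * a ^ 2 + δ ^ (2 - s) * b ^ 2))) :
    X ≤ ENNReal.ofReal (2 * C * a ^ (2 - s) * b ^ s) := by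
  -- For `a = 0` only the term with `δ^(2-s)` remains, and it vanishes as `δ → 0` because `s < 2`.
  rcases ha.eq_or_lt with rfl | ha
  · have hlim : Filter.Tendsto (fun δ : ℝ => ENNReal.ofReal (C * (δ ^ (2 - s) * b ^ 2)))
        (nhdsWithin 0 (Set.Ioi 0)) (nhds (ENNReal.ofReal (C * ((0 : ℝ) ^ (2 - s) * b ^ 2)))) := by
      refine tendsto_nhdsWithin_of_tendsto_nhds ?_
      exact ENNReal.tendsto_ofReal (((Real.continuousAt_rpow_const 0 (2 - s)
        (Or.inr (by linarith))).tendsto.mul_const _).const_mul _)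
    have hX := ge_of_tendsto hlim (b := X) (by
      filter_upwards [self_mem_nhdsWithin] with δ hδ
      simpa using h δ hδ)
    refine hX.trans ?_
    rw [Real.zero_rpow (by linarith)]
    simp
  -- For `b = 0` the scale tends to infinity if `s > 0`. If `s = 0` there is no decay, but the
  -- convention `0^0 = 1` makes the target `2 C a²`, and `δ = 1` suffices.
  rcases hb.eq_or_lt with rfl | hb
  · rcases hs0.eq_or_lt with rfl | hs0
    · refine (h 1 one_pos).trans (ENNReal.ofReal_le_ofReal ?_)
      simp only [neg_zero, Real.rpow_zero, sub_zero, Real.rpow_two]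
      nlinarith [mul_nonneg hC (sq_nonneg a)]
    · have hlim : Filter.Tendsto (fun δ : ℝ => ENNReal.ofReal (C * (δ ^ (-s) * a ^ 2)))
          Filter.atTop (nhds (ENNReal.ofReal (C * (0 * a ^ 2)))) :=
        ENNReal.tendsto_ofReal (((tendsto_rpow_neg_atTop hs0).mul_const _).const_mul _)
      have hX := ge_of_tendsto hlim (b := X) (by
        filter_upwards [Filter.eventually_gt_atTop 0] with δ hδ
        simpa using h δ hδ)
      refine hX.trans ?_
      simp
  -- This scale makes both terms equal to `a^(2-s) b^s`, whence the factor 2.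
  refine (h (a / b) (by positivity)).trans (ENNReal.ofReal_le_ofReal (le_of_eq ?_))
  have e1 : (a / b) ^ (-s) * a ^ 2 = a ^ (2 - s) * b ^ s := by
    rw [Real.div_rpow ha.le hb.le, Real.rpow_neg hb.le, div_inv_eq_mul, sub_eq_add_neg,
      Real.rpow_add ha, Real.rpow_two]
    ring
  have e2 : (a / b) ^ (2 - s) * b ^ 2 = a ^ (2 - s) * b ^ s := by
    rw [Real.div_rpow ha.le hb.le, Real.rpow_sub hb, Real.rpow_two]
    field_simp
  rw [e1, e2]
  ring

/-- The Gagliardo–Nirenberg type bound for the product kernel centred at an arbitrary point. -/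
theorem exists_lintegral_prodKernel_sub_le_rpow {α : Fin d → ℝ}
    (hα0 : ∀ j, 0 ≤ α j) (hα1 : ∀ j, α j < 1) (hα2 : ∑ j, α j < 2) :
    ∃ C : ℝ, 0 < C ∧ ∀ f ∈ sobolevW12 d, ∀ y : EuclideanSpace ℝ (Fin d),
      ∫⁻ x, prodKernel α (x - y) * ‖f x‖ₑ ^ 2 ≤ ENNReal.ofReal C *
        eLpNorm f 2 volume ^ (2 - ∑ j, α j) * eLpNorm (weakGrad f) 2 volume ^ (∑ j, α j) := by
  obtain ⟨C, hC, h⟩ := exists_lintegral_prodKernel_sub_le_of_mem_sobolevW12 hα0 hα1 hα2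
  refine ⟨2 * C, by positivity, fun f hf y => ?_⟩
  have hs0 : 0 ≤ ∑ j, α j := Finset.sum_nonneg fun j _ => hα0 j
  have hfa : eLpNorm f 2 volume ≠ ⊤ := hf.1.eLpNorm_ne_top
  have hfb : eLpNorm (weakGrad f) 2 volume ≠ ⊤ := (weakGrad_spec hf).2.eLpNorm_ne_top
  have h' := fun δ hδ => h f hf δ hδ y
  rw [← ENNReal.ofReal_toReal hfa, ← ENNReal.ofReal_toReal hfb] at h' ⊢
  have ha : 0 ≤ (eLpNorm f 2 volume).toReal := ENNReal.toReal_nonneg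
  have hb : 0 ≤ (eLpNorm (weakGrad f) 2 volume).toReal := ENNReal.toReal_nonneg
  generalize (eLpNorm f 2 volume).toReal = a at *
  generalize (eLpNorm (weakGrad f) 2 volume).toReal = b at *
  generalize ∑ j, α j = s at *
  rw [ENNReal.ofReal_rpow_of_nonneg ha (by linarith), ENNReal.ofReal_rpow_of_nonneg hb hs0,
    ← ENNReal.ofReal_mul (by positivity), ← ENNReal.ofReal_mul (by positivity)]
  refine le_ofReal_of_forall_scale_le ha hb hC.le hs0 hα2 fun δ hδ => (h' δ hδ).trans (le_of_eq ?_)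
  rw [ENNReal.ofReal_mul hC.le, ENNReal.ofReal_add (by positivity) (by positivity),
    ENNReal.ofReal_mul (by positivity), ENNReal.ofReal_mul (by positivity),
    ENNReal.ofReal_pow ha, ENNReal.ofReal_pow hb]

/-- On the unit sphere of `L²`, the potential energy is bounded by half the Dirichlet energy up to
an additive constant. -/
theorem exists_mul_lintegral_prodKernel_le_add {α : Fin d → ℝ}
    (hα0 : ∀ j, 0 ≤ α j) (hα1 : ∀ j, α j < 1) (hα2 : ∑ j, α j < 2) {θ : ℝ} (hθ : 0 < θ) :
    ∃ M : ℝ, ∀ g ∈ unitSobolev d,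
      ENNReal.ofReal θ * ∫⁻ x, prodKernel α x * ‖g x‖ₑ ^ 2
        ≤ ENNReal.ofReal M + 1 / 2 * ∫⁻ x, ‖weakGrad g x‖ₑ ^ 2 := by
  obtain ⟨C, hC, h⟩ := exists_lintegral_prodKernel_sub_le_of_mem_sobolevW12 hα0 hα1 hα2
  set s := ∑ j, α j
  -- The scale solves `θ C δ^(2-s) = 1/2`, so the gradient term is exactly the Dirichlet energy to
  -- be subtracted.
  set δ : ℝ := (1 / (2 * (θ * C))) ^ (1 / (2 - s)) with hδ
  have hδ0 : 0 < δ := by positivity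
  have hδs : θ * (C * δ ^ (2 - s)) = 1 / 2 := by
    rw [hδ, ← Real.rpow_mul (by positivity), one_div_mul_cancel (by linarith), Real.rpow_one]
    field_simp
  refine ⟨θ * (C * δ ^ (-s)), fun g hg => ?_⟩
  have hb := h g hg.1 δ hδ0 0
  simp only [sub_zero, hg.2, one_pow, mul_one] at hb
  refine (mul_le_mul_right hb _).trans (le_of_eq ?_)
  rw [lintegral_enorm_sq_eq_eLpNorm, mul_add, mul_add, ENNReal.ofReal_mul hθ.le,
    ENNReal.ofReal_mul hC.le]
  congr 1
  rw [← mul_assoc (ENNReal.ofReal C), ← mul_assoc, ← ENNReal.ofReal_mul hC.le,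
    ← ENNReal.ofReal_mul hθ.le, hδs, ENNReal.ofReal_div_of_pos two_pos]
  simp

/-- A bound uniform in the centre integrates to a bound for the interaction energy. -/
theorem lintegral_prodKernel_interaction_le {α : Fin d → ℝ}
    {f : EuclideanSpace ℝ (Fin d) → ℝ} (hf : AEStronglyMeasurable f volume) {B : ℝ≥0∞}
    (h : ∀ y, ∫⁻ x, prodKernel α (x - y) * ‖f x‖ₑ ^ 2 ≤ B) :
    ∫⁻ p : EuclideanSpace ℝ (Fin d) × EuclideanSpace ℝ (Fin d),
      prodKernel α (p.1 - p.2) * ‖f p.1‖ₑ ^ 2 * ‖f p.2‖ₑ ^ 2 ≤ B * eLpNorm f 2 volume ^ 2 := by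
  have hm : AEMeasurable (fun p : EuclideanSpace ℝ (Fin d) × EuclideanSpace ℝ (Fin d) =>
      prodKernel α (p.1 - p.2) * ‖f p.1‖ₑ ^ 2 * ‖f p.2‖ₑ ^ 2) (volume.prod volume) :=
    (((measurable_prodKernel α).comp (measurable_fst.sub measurable_snd)).aemeasurable.mul
      (hf.comp_fst.enorm.pow_const 2)).mul (hf.comp_snd.enorm.pow_const 2)
  rw [Measure.volume_eq_prod, lintegral_prod_symm _ hm, ← lintegral_enorm_sq_eq_eLpNorm]
  calc _ ≤ ∫⁻ y, B * ‖f y‖ₑ ^ 2 := by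
        refine lintegral_mono fun y => ?_
        dsimp only
        rw [lintegral_mul_const' _ _ (by finiteness)]
        exact mul_le_mul_left (h y) _
    _ = _ := lintegral_const_mul'' _ (hf.enorm.pow_const 2)

end FormBound

end

theorem lemmaA4 (d : ℕ) (α : Fin d → ℝ) (hα0 : ∀ j, 0 ≤ α j) (hα1 : ∀ j, α j < 1)
    (hα2 : ∑ j, α j < 2) :
    (∀ θ : ℝ, 0 < θ →
      (⨆ g ∈ unitSobolev d,
        ((ENNReal.ofReal θ * ∫⁻ x, prodKernel α x * ‖g x‖ₑ ^ 2 : ℝ≥0∞) : EReal)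
          - ((1 / 2 * ∫⁻ x, ‖weakGrad g x‖ₑ ^ 2 : ℝ≥0∞) : EReal)) < ⊤) ∧
    ∃ C : ℝ, 0 < C ∧
      (∀ f ∈ sobolevW12 d,
        ∫⁻ x, prodKernel α x * ‖f x‖ₑ ^ 2
          ≤ ENNReal.ofReal C * eLpNorm f 2 volume ^ (2 - ∑ j, α j)
            * eLpNorm (weakGrad f) 2 volume ^ (∑ j, α j)) ∧
      (∀ f ∈ sobolevW12 d,
        ∫⁻ p : EuclideanSpace ℝ (Fin d) × EuclideanSpace ℝ (Fin d),
            prodKernel α (p.1 - p.2) * ‖f p.1‖ₑ ^ 2 * ‖f p.2‖ₑ ^ 2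
          ≤ ENNReal.ofReal C * eLpNorm f 2 volume ^ (4 - ∑ j, α j)
            * eLpNorm (weakGrad f) 2 volume ^ (∑ j, α j)) := by
  refine ⟨fun θ hθ => ?_, ?_⟩
  · obtain ⟨M, hM⟩ := exists_mul_lintegral_prodKernel_le_add hα0 hα1 hα2 hθ
    refine lt_of_le_of_lt (iSup₂_le fun g hg => ?_)
      (EReal.coe_ennreal_lt_coe_ennreal_iff.2 (ENNReal.ofReal_lt_top (r := M)))
    -- Moving the energy to the right reduces the claim to an inequality in `[0, ∞]`.
    refine EReal.sub_le_of_le_add ?_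
    rw [← EReal.coe_ennreal_add]
    exact EReal.coe_ennreal_le_coe_ennreal_iff.2 (hM g hg)
  · obtain ⟨C, hC, h⟩ := exists_lintegral_prodKernel_sub_le_rpow hα0 hα1 hα2
    refine ⟨C, hC, fun f hf => by simpa using h f hf 0, fun f hf => ?_⟩
    refine (lintegral_prodKernel_interaction_le hf.1.1 (h f hf)).trans (le_of_eq ?_)
    -- The extra exponent 2 is the mass `‖f‖₂²` from integrating over the centre.
    rw [show (4 - ∑ j, α j) = (2 - ∑ j, α j) + 2 by ring,
      ENNReal.rpow_add_of_nonneg _ _ (by linarith) zero_le_two, ENNReal.rpow_two]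
    ring
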